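/- For a finite simple graph $\Gamma$ and an odd prime $p$, the Mekler group of $\Gamma$ is $$G_\Gamma=\langle V(\Gamma)\mid x^p=1,\ [[x,y],z]=1\ (x,y,z\in V(\Gamma)),\ [x,y]=1\ (\{x,y\}\in E(\Gamma))\rangle .$$ For a finite simple graph $\Gamma_0$, the graph $\mathrm{CFI}(\Gamma_0)$ is defined as follows. For every vertex $v$ of $\Gamma_0$ and every neighbour $w$ of $v$ there are two external vertices $a^v_w,b^v_w$, and for every vertex $v$ there is one internal vertex for each map $m\colon N(v)\to\{0,1\}$ taking the value $1$ an even number of times. The internal vertex $m$ of $v$ is adjacent, for each $w\in N(v)$, to $a^v_w$ if $m(w)=0$ and to $b^v_w$ if $m(w)=1$. For every edge $\{v,w\}$ of $\Gamma_0$ there are the edges $\{a^v_w,a^w_v\}$ and $\{b^v_w,b^w_v\}$. There are no further edges. The twisted graph $\widetilde{\mathrm{CFI}(\Gamma_0)}$ is obtained by choosing one edge $\{v,w\}$ of $\Gamma_0$ and replacing these two edges by $\{a^v_w,b^w_v\}$ and $\{b^v_w,a^w_v\}$. The $k$-subgroup profile of a finite group $G$ is the multiset of isomorphism types of the $k$-generated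 subgroups of $G$ (the subgroups generated by at most $k$ elements, each subgroup counted once). Let $\Gamma_0$ be a finite connected $3$-regular graph with $N$ edges, let $p$ be an odd prime, and let $G_1$ and $G_2$ be the Mekler groups, with respect to $p$, of $\mathrm{CFI}(\Gamma_0)$ and of $\widetilde{\mathrm{CFI}(\Gamma_0)}$, where any edge of $\Gamma_0$ may be chosen for the twist. Then $G_1$ and $G_2$ have equal $k$-subgroup profiles for every integer $k$ with $0\le k<N/10$; that is, there is a bijection from the $k$-generated subgroups of $G_1$ to those of $G_2$ that maps every subgroup to an isomorphic one. -/

import Mathlib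

universe u v

/-- Vertices of the CFI graphs over `Γ`. The external vertex `Sum.inl (d, x)` lies in the gadget of
`d.fst` and belongs to the edge from `d.fst` to `d.snd`; `x = 0` gives the vertex called `a`,
`x = 1` the one called `b`. The internal vertex `Sum.inr ⟨v, m⟩` is the 0-1-string `m`, indexed by
the neighbours of `v`, with an even number of entries equal to 1. -/
abbrev CFIVertex {V : Type u} (Γ : SimpleGraph V) [Γ.LocallyFinite] : Type u :=
  (Γ.Dart × ZMod 2) ⊕ (Σ v : V, {m : Γ.neighborSet v → ZMod 2 // ∑ w, m w = 0})

/-- The internal vertex `m` of the gadget of `v` is joined to the external vertex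
with bit `m w` of the pair belonging to the edge from `v` to `w`. -/
def CFIGadgetAdj {V : Type u} (Γ : SimpleGraph V) [Γ.LocallyFinite]
    (o : Γ.Dart × ZMod 2) (i : Σ v : V, {m : Γ.neighborSet v → ZMod 2 // ∑ w, m w = 0}) : Prop :=
  ∃ w : Γ.neighborSet i.1, o.1.toProd = (i.1, (w : V)) ∧ i.2.1 w = o.2

/-- External vertices of different gadgets are joined along the edges of `Γ`, in parallel
(`a`-`a`, `b`-`b`) over an edge outside `T`, and crosswise (`a`-`b`, `b`-`a`) over an edge
in `T`. -/
def CFILinkAdj {V : Type u} (Γ : SimpleGraph V) (T : Set (Sym2 V))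
    (o o' : Γ.Dart × ZMod 2) : Prop :=
  o'.1 = o.1.symm ∧ (o.2 = o'.2 ↔ o.1.edge ∉ T)

/-- The CFI graph over `Γ` in which exactly the edges in `T` are twisted. -/
def CFIGraphTwistedAt {V : Type u} (Γ : SimpleGraph V) [Γ.LocallyFinite] (T : Set (Sym2 V)) :
    SimpleGraph (CFIVertex Γ) where
  Adj
    | Sum.inl o, Sum.inl o' => CFILinkAdj Γ T o o'
    | Sum.inl o, Sum.inr i => CFIGadgetAdj Γ o i
    | Sum.inr i, Sum.inl o => CFIGadgetAdj Γ o i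
    | Sum.inr _, Sum.inr _ => False
  symm := by
    refine ⟨?_⟩
    rintro (⟨d, x⟩ | i) (⟨d', y⟩ | j) h
    · obtain ⟨h1, h2⟩ := h
      simp only at h1 h2
      subst h1
      exact ⟨by simp, by simpa [eq_comm] using h2⟩
    · exact h
    · exact h
    · exact h
  loopless := by
    refine ⟨?_⟩
    rintro (⟨d, x⟩ | i) h
    · exact d.symm_ne h.1.symm
    · exact h

/-- The graph `CFI(Γ)`. -/
def CFIGraph {V : Type u} (Γ : SimpleGraph V) [Γ.LocallyFinite] : SimpleGraph (CFIVertex Γ) :=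
  CFIGraphTwistedAt Γ ∅

/-- The twisted CFI graph of `Γ`, with the twist at the edge `e`. -/
def twistedCFIGraph {V : Type u} (Γ : SimpleGraph V) [Γ.LocallyFinite] (e : Sym2 V) :
    SimpleGraph (CFIVertex Γ) :=
  CFIGraphTwistedAt Γ {e}

open scoped commutatorElement in
/-- The relators `x ^ p` and `[[x, y], z]` for all generators, and `[x, y]` for all edges. -/
def meklerRels (p : ℕ) {W : Type u} (Γ : SimpleGraph W) : Set (FreeGroup W) :=
  {r | ∃ x : W, r = FreeGroup.of x ^ p} ∪
  {r | ∃ x y z : W, r = ⁅⁅FreeGroup.of x, FreeGroup.of y⁆, FreeGroup.of z⁆} ∪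
  {r | ∃ x y : W, Γ.Adj x y ∧ r = ⁅FreeGroup.of x, FreeGroup.of y⁆}

/-- The Mekler group of the graph `Γ` with respect to `p`. -/
abbrev MeklerGroup (p : ℕ) {W : Type u} (Γ : SimpleGraph W) : Type u :=
  PresentedGroup (meklerRels p Γ)

/-- The subgroup `S` is generated by `k` elements (repetitions allowed, so by at most `k`). -/
def Subgroup.IsKGenerated {G : Type u} [Group G] (k : ℕ) (S : Subgroup G) : Prop :=
  ∃ g : Fin k → G, Subgroup.closure (Set.range g) = S

/-- `G` and `H` have the same multiset of isomorphism types of `k`-generated subgroups. -/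
def HaveEqualSubgroupProfiles (k : ℕ) (G : Type u) (H : Type v) [Group G] [Group H] : Prop :=
  ∃ Φ : {S : Subgroup G // S.IsKGenerated k} ≃ {S : Subgroup H // S.IsKGenerated k},
    ∀ S, Nonempty (S.1 ≃* (Φ S).1)

/-!
The Mekler group is the central extension, with half the exterior product as cocycle, of the vector
space on the vertices by its exterior square modulo the products `x ∧ y` over the edges `xy`. The
projections of the elements of a `k`-generated subgroup span a space `U` of dimension at most `k`,
and the group law of the subgroup depends only on the cocycle on `U`.

The two ends of an edge of `Γ₀` are joined by a perfect matching of external vertices, so a twist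
at this edge affects the cocycle on `U` only if some vector of `U` has exactly one external vertex
in its support, and that vertex belongs to the edge. Vectors isolating external vertices of
different edges are linearly independent, so some edge is free if `k` is less than the number of
edges. Flipping gadgets along a path moves the twist from a free edge to any other edge. The set of
free edges is invariant under flips; hence, if the flip is chosen according to this set, the
resulting map of subgroups is still bijective.
-/

theorem bijective_choice_of_invariant {X X' I I' : Type*} {ρ : X → I} {ρ' : X' → I'}
    {g : I → X → X'} {h : I → I → I'} (hg : ∀ i, Function.Bijective (g i))
    (hρ : ∀ i x, ρ' (g i x) = h i (ρ x)) (hinj : ∀ i, Function.Injective (h i))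
    (hdiag : Function.Bijective fun i => h i i) :
    Function.Bijective fun x => g (ρ x) x := by
  refine ⟨fun x y hxy => ?_, fun x' => ?_⟩
  · have hi : ρ x = ρ y := hdiag.injective <| by
      simpa only [hρ] using congrArg ρ' hxy
    exact (hg (ρ y)).injective (by simpa only [hi] using hxy)
  · obtain ⟨i, hi⟩ := hdiag.surjective (ρ' x')
    obtain ⟨x, rfl⟩ := (hg i).surjective x'
    have hx : ρ x = i := hinj i (by rw [← hρ]; exact hi.symm)
    exact ⟨x, by simp only [hx]⟩

theorem exists_linearEquiv_comp_eq {F L C C' : Type*} [Field F] [AddCommGroup L] [Module F L]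
    [FiniteDimensional F L] [AddCommGroup C] [Module F C] [AddCommGroup C'] [Module F C']
    (e : C ≃ₗ[F] C') {f : L →ₗ[F] C} {g : L →ₗ[F] C'} (h : LinearMap.ker f = LinearMap.ker g) :
    ∃ γ : C ≃ₗ[F] C', ∀ z, γ (f z) = g z := by
  set g' : L →ₗ[F] C := e.symm.toLinearMap ∘ₗ g with hg'
  have hker : LinearMap.ker f = LinearMap.ker g' := by rw [hg', LinearEquiv.ker_comp, h]
  obtain ⟨γ, hγ⟩ := Submodule.exists_linearEquiv_restrict_eq <|
    f.quotKerEquivRange.symm ≪≫ₗ Submodule.quotEquivOfEq _ _ hker ≪≫ₗ g'.quotKerEquivRange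
  refine ⟨γ ≪≫ₗ e, fun z => ?_⟩
  have hmk : f.quotKerEquivRange.symm ⟨f z, z, rfl⟩ = Submodule.Quotient.mk z :=
    f.quotKerEquivRange.symm_apply_eq.2 rfl
  have hz : g' z = γ (f z) := by
    simpa only [LinearEquiv.trans_apply, hmk, Submodule.quotEquivOfEq_mk,
      LinearMap.quotKerEquivRange_apply_mk] using hγ ⟨f z, z, rfl⟩
  rw [LinearEquiv.trans_apply, ← hz]
  exact e.apply_symm_apply (g z)

/-! ### Subgroups generated by `k` elements -/

section KGenerated

variable {G H K : Type*} [Group G] [Group H] [Group K] {k : ℕ}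

theorem isKGenerated_map {S : Subgroup G} (f : G →* H) (hS : S.IsKGenerated k) :
    (S.map f).IsKGenerated k := by
  obtain ⟨g, rfl⟩ := hS
  exact ⟨f ∘ g, by rw [Set.range_comp, MonoidHom.map_closure]⟩

theorem isKGenerated_top {S : Subgroup G} (hS : S.IsKGenerated k) :
    (⊤ : Subgroup S).IsKGenerated k := by
  obtain ⟨g, rfl⟩ := hS
  refine ⟨fun i => ⟨g i, Subgroup.subset_closure ⟨i, rfl⟩⟩, ?_⟩
  rw [← Subgroup.closure_closure_coe_preimage]
  congr 1
  ext x
  simp [Subtype.ext_iff]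

theorem isKGenerated_of_mulEquiv {S : Subgroup G} {S' : Subgroup H} (f : S ≃* S')
    (hS : S.IsKGenerated k) : S'.IsKGenerated k := by
  have h := isKGenerated_map (S'.subtype.comp f.toMonoidHom) (isKGenerated_top hS)
  rwa [← Subgroup.map_map, Subgroup.map_top_of_surjective _ f.surjective, ← MonoidHom.range_eq_map,
    S'.range_subtype] at h

theorem exists_subgroup_coe_eq_image (S : Subgroup G) {f : G → H} (hinj : Function.Injective f)
    (hf : ∀ a ∈ S, ∀ b ∈ S, f (a * b) = f a * f b) :
    ∃ S' : Subgroup H, (S' : Set H) = f '' S ∧ Nonempty (S ≃* S') := by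
  let φ : S →* H := MonoidHom.mk' (fun a => f a) fun a b => hf a a.2 b b.2
  refine ⟨φ.range, ?_, ⟨φ.ofInjective fun a b h => Subtype.ext (hinj h)⟩⟩
  ext y
  simp [φ]

namespace HaveEqualSubgroupProfiles

theorem trans (h : HaveEqualSubgroupProfiles k G H) (h' : HaveEqualSubgroupProfiles k H K) :
    HaveEqualSubgroupProfiles k G K := by
  obtain ⟨Φ, hΦ⟩ := h
  obtain ⟨Ψ, hΨ⟩ := h'
  refine ⟨Φ.trans Ψ, fun S => ?_⟩
  obtain ⟨i⟩ := hΦ S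
  obtain ⟨j⟩ := hΨ (Φ S)
  exact ⟨i.trans j⟩

/-- The subgroups are treated as sets, so that `Ψ` may be described without regard to which sets
are subgroups. -/
theorem of_set_equiv (Ψ : Set G ≃ Set H)
    (hΨ : ∀ S : Subgroup G, S.IsKGenerated k →
      ∃ S' : Subgroup H, (S' : Set H) = Ψ S ∧ Nonempty (S ≃* S'))
    (hΨ' : ∀ S' : Subgroup H, S'.IsKGenerated k →
      ∃ S : Subgroup G, (S : Set G) = Ψ.symm S' ∧ Nonempty (S' ≃* S)) :
    HaveEqualSubgroupProfiles k G H := by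
  choose Φ hΦ hiso using hΨ
  choose Φ' hΦ' hiso' using hΨ'
  refine ⟨⟨fun S => ⟨Φ S.1 S.2, isKGenerated_of_mulEquiv (hiso S.1 S.2).some S.2⟩,
    fun S' => ⟨Φ' S'.1 S'.2, isKGenerated_of_mulEquiv (hiso' S'.1 S'.2).some S'.2⟩,
    fun S => ?_, fun S' => ?_⟩, fun S => hiso S.1 S.2⟩
  · exact Subtype.ext (SetLike.coe_injective (by simp [hΦ, hΦ']))
  · exact Subtype.ext (SetLike.coe_injective (by simp [hΦ, hΦ']))

theorem of_mulEquiv (f : G ≃* H) : HaveEqualSubgroupProfiles k G H :=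
  of_set_equiv (Equiv.Set.congr f.toEquiv)
    (fun S _ => ⟨S.map f.toMonoidHom, rfl, ⟨f.subgroupMap S⟩⟩)
    (fun S' _ => ⟨S'.map f.symm.toMonoidHom, rfl, ⟨f.symm.subgroupMap S'⟩⟩)

end HaveEqualSubgroupProfiles

end KGenerated

/-! ### Central extensions with bilinear cocycle -/

/-- The central extension of `A` by `C` whose cocycle is the bilinear map `B`. -/
@[ext]
structure BilinExt {R A C : Type*} [CommRing R] [AddCommGroup A] [Module R A] [AddCommGroup C]
    [Module R C] (B : A →ₗ[R] A →ₗ[R] C) where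
  /-- The image in `A`. -/
  fst : A
  /-- The central coordinate. -/
  snd : C

namespace BilinExt

open scoped commutatorElement

variable {R A C A' C' : Type*} [CommRing R] [AddCommGroup A] [Module R A] [AddCommGroup C]
  [Module R C] [AddCommGroup A'] [Module R A'] [AddCommGroup C'] [Module R C']
  {B : A →ₗ[R] A →ₗ[R] C} {B' : A' →ₗ[R] A' →ₗ[R] C'}

instance : Mul (BilinExt B) := ⟨fun a b => ⟨a.fst + b.fst, a.snd + b.snd + B a.fst b.fst⟩⟩

instance : One (BilinExt B) := ⟨⟨0, 0⟩⟩

instance : Inv (BilinExt B) := ⟨fun a => ⟨-a.fst, -a.snd + B a.fst a.fst⟩⟩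

@[simp] theorem fst_mul (a b : BilinExt B) : (a * b).fst = a.fst + b.fst := rfl

@[simp] theorem snd_mul (a b : BilinExt B) : (a * b).snd = a.snd + b.snd + B a.fst b.fst := rfl

@[simp] theorem fst_one : (1 : BilinExt B).fst = 0 := rfl

@[simp] theorem snd_one : (1 : BilinExt B).snd = 0 := rfl

@[simp] theorem fst_inv (a : BilinExt B) : a⁻¹.fst = -a.fst := rfl

@[simp] theorem snd_inv (a : BilinExt B) : a⁻¹.snd = -a.snd + B a.fst a.fst := rfl

instance : Group (BilinExt B) :=
  Group.ofLeftAxioms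
    (fun a b c => by
      ext
      · simp [add_assoc]
      · simp only [snd_mul, fst_mul, map_add, LinearMap.add_apply]
        abel)
    (fun a => by ext <;> simp)
    (fun a => by ext <;> simp)

/-- The projection of the extension onto the quotient `A`. -/
def fstHom (B : A →ₗ[R] A →ₗ[R] C) : BilinExt B →* Multiplicative A where
  toFun a := .ofAdd a.fst
  map_one' := rfl
  map_mul' _ _ := rfl

theorem commutatorElement_eq (a b : BilinExt B) :
    ⁅a, b⁆ = ⟨0, B a.fst b.fst - B b.fst a.fst⟩ := by
  rw [commutatorElement_def]
  ext
  · simp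
  · simp only [snd_mul, fst_mul, snd_inv, fst_inv, map_add, map_neg, LinearMap.add_apply,
      LinearMap.neg_apply]
    abel

theorem pow_eq (hB : B.IsAlt) (a : BilinExt B) (n : ℕ) : a ^ n = ⟨n • a.fst, n • a.snd⟩ := by
  induction n with
  | zero => ext <;> simp
  | succ n ih =>
    have h : B a.fst a.fst = 0 := hB a.fst
    rw [pow_succ, ih]
    ext <;> simp [h, add_smul]

/-- The bijection of extensions induced by isomorphisms of quotient and kernel; it is
multiplicative only as far as the isomorphisms respect the cocycles. -/
@[simps]
def congr (B : A →ₗ[R] A →ₗ[R] C) (B' : A' →ₗ[R] A' →ₗ[R] C') (α : A ≃ₗ[R] A')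
    (γ : C ≃ₗ[R] C') : BilinExt B ≃ BilinExt B' where
  toFun a := ⟨α a.fst, γ a.snd⟩
  invFun a := ⟨α.symm a.fst, γ.symm a.snd⟩
  left_inv a := by simp
  right_inv a := by simp

theorem congr_mul {α : A ≃ₗ[R] A'} {γ : C ≃ₗ[R] C'} {a b : BilinExt B}
    (h : γ (B a.fst b.fst) = B' (α a.fst) (α b.fst)) :
    congr B B' α γ (a * b) = congr B B' α γ a * congr B B' α γ b := by
  ext <;> simp [h]

/-- The span of the projections to `A` of the elements of `s`. It is the invariant by which the
isomorphism transporting a subgroup is chosen. -/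
def shadow (s : Set (BilinExt B)) : Submodule R A :=
  Submodule.span R (fst '' s)

theorem fst_mem_shadow {s : Set (BilinExt B)} {a : BilinExt B} (ha : a ∈ s) :
    a.fst ∈ shadow s :=
  Submodule.subset_span ⟨a, ha, rfl⟩

theorem shadow_image_congr (α : A ≃ₗ[R] A') (γ : C ≃ₗ[R] C') (s : Set (BilinExt B)) :
    shadow (congr B B' α γ '' s) = (shadow s).map (α : A →ₗ[R] A') := by
  rw [shadow, shadow, Submodule.map_span, Set.image_image, Set.image_image]
  rfl

theorem shadow_closure (s : Set (BilinExt B)) :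
    shadow ((Subgroup.closure s : Subgroup (BilinExt B)) : Set (BilinExt B)) = shadow s := by
  refine le_antisymm (Submodule.span_le.2 ?_)
    (Submodule.span_mono (Set.image_mono Subgroup.subset_closure))
  rintro _ ⟨a, ha, rfl⟩
  induction ha using Subgroup.closure_induction with
  | mem a ha => exact fst_mem_shadow ha
  | one => exact Submodule.zero_mem _
  | mul a b _ _ ha hb => exact Submodule.add_mem _ ha hb
  | inv a _ ha => exact Submodule.neg_mem _ ha

theorem exists_span_range_eq_shadow {k : ℕ} {S : Subgroup (BilinExt B)} (hS : S.IsKGenerated k) :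
    ∃ g : Fin k → A, Submodule.span R (Set.range g) = shadow (S : Set (BilinExt B)) := by
  obtain ⟨g, rfl⟩ := hS
  exact ⟨fst ∘ g, by rw [shadow_closure, shadow, Set.range_comp]⟩

variable {k : ℕ}

theorem exists_span_range_eq_of_map {U : Submodule R A} (α : A ≃ₗ[R] A') {g : Fin k → A'}
    (hg : Submodule.span R (Set.range g) = U.map (α : A →ₗ[R] A')) :
    ∃ g : Fin k → A, Submodule.span R (Set.range g) = U := by
  refine ⟨α.symm ∘ g, Submodule.map_injective_of_injective α.injective ?_⟩
  rw [← hg, Submodule.map_span, ← Set.range_comp]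
  congr 2
  ext i
  simp

/-- The isomorphism transporting a subgroup may depend on its shadow `U`, because the induced maps
`σ U` still permute the submodules. -/
theorem haveEqualSubgroupProfiles (σ : Submodule R A → A ≃ₗ[R] A')
    (hσ : Function.Bijective fun U : Submodule R A => U.map (σ U : A →ₗ[R] A'))
    (h : ∀ U, (∃ g : Fin k → A, Submodule.span R (Set.range g) = U) →
      ∃ γ : C ≃ₗ[R] C', ∀ u ∈ U, ∀ v ∈ U, γ (B u v) = B' (σ U u) (σ U v)) :
    HaveEqualSubgroupProfiles k (BilinExt B) (BilinExt B') := by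
  classical
  obtain ⟨γ₀, -⟩ := h _ ⟨0, rfl⟩
  have : Nonempty (C ≃ₗ[R] C') := ⟨γ₀⟩
  choose! γ hγ using h
  let f (U : Submodule R A) : BilinExt B ≃ BilinExt B' := congr B B' (σ U) (γ U)
  have hbij : Function.Bijective fun s : Set (BilinExt B) => f (shadow s) '' s :=
    bijective_choice_of_invariant (ρ := shadow) (ρ' := shadow)
      (h := fun U U' => U'.map (σ U : A →ₗ[R] A'))
      (fun U => (Equiv.Set.congr (f U)).bijective) (fun U s => shadow_image_congr _ _ s)
      (fun U => Submodule.map_injective_of_injective (σ U).injective) hσ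
  refine .of_set_equiv (Equiv.ofBijective _ hbij) (fun S hS => ?_) (fun S' hS' => ?_)
  · exact exists_subgroup_coe_eq_image S (f _).injective fun a ha b hb =>
      congr_mul <| hγ _ (exists_span_range_eq_shadow hS) _ (fst_mem_shadow ha) _ (fst_mem_shadow hb)
  · obtain ⟨s, hs : f (shadow s) '' s = S'⟩ := hbij.surjective S'
    have hs' : s = (f (shadow s)).symm '' S' := by rw [← hs, Equiv.symm_image_image]
    have hgen : ∃ g : Fin k → A, Submodule.span R (Set.range g) = shadow s := by
      obtain ⟨g, hg⟩ := exists_span_range_eq_shadow hS'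
      rw [← hs, shadow_image_congr] at hg
      exact exists_span_range_eq_of_map (σ (shadow s)) hg
    have hmem {a} (ha : a ∈ S') : ((f (shadow s)).symm a).fst ∈ shadow s :=
      fst_mem_shadow (hs'.ge ⟨a, ha, rfl⟩)
    rw [show (Equiv.ofBijective _ hbij).symm S' = s from (Equiv.symm_apply_eq _).2 hs.symm]
    nth_rw 1 [hs']
    refine exists_subgroup_coe_eq_image S' (f (shadow s)).symm.injective fun a ha b hb => ?_
    rw [Equiv.symm_apply_eq]
    refine .trans ?_ (congr_mul <| hγ _ hgen _ (hmem ha) _ (hmem hb)).symm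
    rw [Equiv.apply_symm_apply, Equiv.apply_symm_apply]

end BilinExt

/-! ### The cocycle of a graph -/

section MeklerCocycle

variable {R F W W' : Type*} [CommRing R] [Field F]

variable (R W) in
/-- The tensor product of finitely supported functions as a bilinear map. -/
noncomputable def outerProduct : (W →₀ R) →ₗ[R] (W →₀ R) →ₗ[R] (W × W →₀ R) :=
  (TensorProduct.mk R (W →₀ R) (W →₀ R)).compr₂ (finsuppTensorFinsupp' R W W).toLinearMap

@[simp] theorem outerProduct_apply (u v : W →₀ R) (q : W × W) :
    outerProduct R W u v q = u q.1 * v q.2 :=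
  finsuppTensorFinsupp'_apply_apply R W W u v q.1 q.2

theorem outerProduct_single_single (x y : W) (a b : R) :
    outerProduct R W (.single x a) (.single y b) = .single (x, y) (a * b) :=
  finsuppTensorFinsupp'_single_tmul_single R W W x y a b

/-- Tensors with symmetric coefficients off the edges of the graph. If `2` is invertible, these are
the tensors that vanish in the quotient of the exterior square of `W →₀ R` by the products
`x ∧ y` over the edges `xy`. -/
def symmetricOffEdges (R : Type*) [CommRing R] (Γ : SimpleGraph W) :
    Submodule R (W × W →₀ R) where
  carrier := {z | ∀ q, ¬ Γ.Adj q.1 q.2 → z q.swap = z q}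
  zero_mem' _ _ := rfl
  add_mem' hy hz q hq := congrArg₂ (· + ·) (hy q hq) (hz q hq)
  smul_mem' c _ hz q hq := congrArg (c • ·) (hz q hq)

theorem outerProduct_single_single_mem_symmetricOffEdges {Γ : SimpleGraph W} {x y : W}
    (hxy : Γ.Adj x y) (a b : R) :
    outerProduct R W (.single x a) (.single y b) ∈ symmetricOffEdges R Γ := by
  intro q hq
  rw [outerProduct_single_single, Finsupp.single_eq_of_ne, Finsupp.single_eq_of_ne]
  · rintro rfl
    exact hq hxy
  · intro h
    rw [← Prod.swap_swap q, h] at hq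
    exact hq hxy.symm

/-- The exterior square of `W →₀ R` modulo the products `x ∧ y` over the edges `xy` of the graph. -/
abbrev MeklerCenter (R : Type*) [CommRing R] (Γ : SimpleGraph W) : Type _ :=
  (W × W →₀ R) ⧸ symmetricOffEdges R Γ

/-- Half the exterior product, so that commutators in the extension are exterior products. -/
noncomputable def meklerCocycle (F : Type*) [Field F] (Γ : SimpleGraph W) :
    (W →₀ F) →ₗ[F] (W →₀ F) →ₗ[F] MeklerCenter F Γ :=
  (2⁻¹ : F) • (outerProduct F W).compr₂ (symmetricOffEdges F Γ).mkQ

theorem meklerCocycle_apply (Γ : SimpleGraph W) (u v : W →₀ F) :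
    meklerCocycle F Γ u v = (2⁻¹ : F) • (symmetricOffEdges F Γ).mkQ (outerProduct F W u v) :=
  rfl

theorem meklerCocycle_isAlt (Γ : SimpleGraph W) : (meklerCocycle F Γ).IsAlt := fun u => by
  have h : outerProduct F W u u ∈ symmetricOffEdges F Γ := fun q _ => by simp [mul_comm]
  rw [meklerCocycle_apply, Submodule.mkQ_apply, (Submodule.Quotient.mk_eq_zero _).2 h, smul_zero]

theorem meklerCocycle_sub_flip [NeZero (2 : F)] (Γ : SimpleGraph W) (u v : W →₀ F) :
    meklerCocycle F Γ u v - meklerCocycle F Γ v u =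
      (symmetricOffEdges F Γ).mkQ (outerProduct F W u v) := by
  have h2 : (2 : F) ≠ 0 := two_ne_zero
  rw [meklerCocycle_apply, meklerCocycle_apply, ← map_smul (Submodule.mkQ _),
    ← map_smul (Submodule.mkQ _), ← map_sub]
  refine (Submodule.Quotient.eq _).2 fun q _ => ?_
  simp only [Finsupp.sub_apply, Finsupp.smul_apply, outerProduct_apply, smul_eq_mul, Prod.fst_swap,
    Prod.snd_swap]
  field_simp
  ring

/-- The isomorphism induced by a bijection of the pairs of vertices that respects orientation
reversal and edges. It need not come from a map of vertices. -/
noncomputable def meklerCenterCongr (R : Type*) [CommRing R] {Γ : SimpleGraph W}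
    {Γ' : SimpleGraph W'} (τ : W × W ≃ W' × W') (hswap : ∀ q, τ q.swap = (τ q).swap)
    (hadj : ∀ q, Γ'.Adj (τ q).1 (τ q).2 ↔ Γ.Adj q.1 q.2) :
    MeklerCenter R Γ ≃ₗ[R] MeklerCenter R Γ' :=
  Submodule.Quotient.equiv _ _ (Finsupp.domLCongr τ) <| by
    ext z
    rw [Submodule.map_equiv_eq_comap_symm, Submodule.mem_comap]
    change (∀ q, ¬ Γ.Adj q.1 q.2 → z (τ q.swap) = z (τ q)) ↔
      ∀ q', ¬ Γ'.Adj q'.1 q'.2 → z q'.swap = z q'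
    rw [← τ.forall_congr_right]
    simp only [hadj, hswap]

theorem exists_meklerCocycle_congr {Γ : SimpleGraph W} {Γ' : SimpleGraph W'} (φ : Γ ≃g Γ') :
    ∃ γ : MeklerCenter F Γ ≃ₗ[F] MeklerCenter F Γ', ∀ u v, γ (meklerCocycle F Γ u v) =
      meklerCocycle F Γ' (Finsupp.domLCongr (R := F) φ.toEquiv u)
        (Finsupp.domLCongr (R := F) φ.toEquiv v) := by
  refine ⟨meklerCenterCongr F (φ.toEquiv.prodCongr φ.toEquiv) (fun _ => rfl)
    (fun q => φ.map_adj_iff), fun u v => ?_⟩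
  rw [meklerCocycle_apply, meklerCocycle_apply, map_smul]
  refine congrArg (fun z => (2⁻¹ : F) • (symmetricOffEdges F Γ').mkQ z) (Finsupp.ext fun q => ?_)
  simp

/-- The antisymmetrization of `z / 2` differs from `z` by a symmetric tensor and is, modulo edges,
zero; so the hypotheses determine `f z`. -/
theorem eq_zero_of_mem_symmetricOffEdges [NeZero (2 : F)] {A : Type*} [AddCommGroup A]
    {Γ : SimpleGraph W} (f : (W × W →₀ F) →+ A)
    (hswap : ∀ q a, f (.single q.swap a) = -f (.single q a))
    (hadj : ∀ q a, Γ.Adj q.1 q.2 → f (.single q a) = 0) {z : W × W →₀ F}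
    (hz : z ∈ symmetricOffEdges F Γ) : f z = 0 := by
  have hneg (y : W × W →₀ F) : f (Finsupp.domLCongr (R := F) (Equiv.prodComm W W) y) = -f y := by
    induction y using Finsupp.induction_linear with
    | zero => simp
    | add y z hy hz => rw [map_add, map_add, map_add, hy, hz, neg_add]
    | single q a => simp [hswap]
  have hedges (y : W × W →₀ F) (hy : ∀ q, ¬ Γ.Adj q.1 q.2 → y q = 0) : f y = 0 := by
    rw [← y.sum_single, Finsupp.sum, map_sum]
    refine Finset.sum_eq_zero fun q hq => hadj q _ ?_
    by_contra h
    exact Finsupp.mem_support_iff.1 hq (hy q h)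
  set y := (2⁻¹ : F) • z
  have hy : z = y + y := by rw [← two_smul F, smul_inv_smul₀ two_ne_zero]
  rw [hy, map_add, ← sub_neg_eq_add, ← hneg, ← map_sub]
  refine hedges _ fun q hq => ?_
  simp [y, hz q hq]

end MeklerCocycle

/-! ### The Mekler group as a central extension -/

section ZModFinsupp

variable {n : ℕ} {ι A : Type*} [AddCommGroup A]

/-- The additive map on the free `ZMod n`-module over `ι` with prescribed values on the basis. -/
noncomputable def zmodFinsuppLift (a : ι → A) (ha : ∀ i, n • a i = 0) : (ι →₀ ZMod n) →+ A :=
  Finsupp.liftAddHom fun i => ZMod.lift n ⟨zmultiplesHom A (a i), by simpa using ha i⟩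

theorem zmodFinsuppLift_single_one (a : ι → A) (ha : ∀ i, n • a i = 0) (i : ι) :
    zmodFinsuppLift a ha (.single i 1) = a i := by
  rw [zmodFinsuppLift, Finsupp.liftAddHom_apply_single, ← Int.cast_one (R := ZMod n),
    ZMod.lift_coe]
  simp

theorem zmodFinsupp_induction [NeZero n] {motive : (ι →₀ ZMod n) → Prop} (zero : motive 0)
    (single : ∀ i, motive (.single i 1)) (add : ∀ y z, motive y → motive z → motive (y + z))
    (z : ι →₀ ZMod n) : motive z := by
  induction z using Finsupp.induction_linear with
  | zero => exact zero
  | add y z hy hz => exact add y z hy hz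
  | single i a =>
    obtain ⟨m, rfl⟩ := ZMod.natCast_zmod_surjective a
    induction m with
    | zero => simpa using zero
    | succ m ih =>
      rw [Nat.cast_succ, Finsupp.single_add]
      exact add _ _ ih (single i)

end ZModFinsupp

open scoped commutatorElement in
theorem commutator_le_of_closure_eq_top {G : Type*} [Group G] {s : Set G}
    (hs : Subgroup.closure s = ⊤) (N : Subgroup G) [N.Normal]
    (h : ∀ a ∈ s, ∀ b ∈ s, ⁅a, b⁆ ∈ N) : commutator G ≤ N := by
  rw [← QuotientGroup.ker_mk' N, ← Subgroup.map_eq_bot_iff, commutator_def,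
    Subgroup.map_commutator, Subgroup.commutator_eq_bot_iff_le_centralizer, ← hs,
    MonoidHom.map_closure, Subgroup.closure_le, Subgroup.centralizer_closure]
  rintro _ ⟨a, ha, rfl⟩
  rw [SetLike.mem_coe, Subgroup.mem_centralizer_iff]
  rintro _ ⟨b, hb, rfl⟩
  rw [← commutatorElement_eq_one_iff_mul_comm, ← map_commutatorElement]
  exact (QuotientGroup.eq_one_iff _).2 (h b hb a ha)

namespace MeklerGroup

open scoped commutatorElement IsMulCommutative

variable {p : ℕ} {W : Type*} {Γ : SimpleGraph W}

/-- The generator of the Mekler group at a vertex. -/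
def gen (p : ℕ) (Γ : SimpleGraph W) (x : W) : MeklerGroup p Γ := PresentedGroup.of x

theorem gen_pow (x : W) : gen p Γ x ^ p = 1 := by
  have h : FreeGroup.of x ^ p ∈ meklerRels p Γ := Or.inl (Or.inl ⟨x, rfl⟩)
  exact PresentedGroup.one_of_mem h

theorem commutator_commutator_gen (x y z : W) : ⁅⁅gen p Γ x, gen p Γ y⁆, gen p Γ z⁆ = 1 := by
  have h : ⁅⁅FreeGroup.of x, FreeGroup.of y⁆, FreeGroup.of z⁆ ∈ meklerRels p Γ :=
    Or.inl (Or.inr ⟨x, y, z, rfl⟩)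
  exact PresentedGroup.one_of_mem h

theorem commutator_gen_of_adj {x y : W} (hxy : Γ.Adj x y) : ⁅gen p Γ x, gen p Γ y⁆ = 1 := by
  have h : ⁅FreeGroup.of x, FreeGroup.of y⁆ ∈ meklerRels p Γ := Or.inr ⟨x, y, hxy, rfl⟩
  exact PresentedGroup.one_of_mem h

theorem commutator_gen_mem_center (x y : W) :
    ⁅gen p Γ x, gen p Γ y⁆ ∈ Subgroup.center (MeklerGroup p Γ) := by
  have h : ∀ g, g ∈ Subgroup.centralizer {⁅gen p Γ x, gen p Γ y⁆} :=
    PresentedGroup.generated_by _ _ fun z => by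
      rw [Subgroup.mem_centralizer_singleton_iff]
      exact (commutatorElement_eq_one_iff_mul_comm.1 (commutator_commutator_gen x y z)).symm
  exact Subgroup.mem_center_iff.2 fun g => Subgroup.mem_centralizer_singleton_iff.1 (h g)

theorem commutator_gen_pow (x y : W) : ⁅gen p Γ x, gen p Γ y⁆ ^ p = 1 := by
  have hc : ∀ g, Commute g ⁅gen p Γ x, gen p Γ y⁆ :=
    Subgroup.mem_center_iff.1 (commutator_gen_mem_center x y)
  have hconj : gen p Γ x * gen p Γ y * (gen p Γ x)⁻¹ = ⁅gen p Γ x, gen p Γ y⁆ * gen p Γ y := by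
    rw [commutatorElement_def]; group
  have h := congrArg (· ^ p) hconj
  simp only [conj_pow, gen_pow, mul_one, mul_inv_cancel, (hc _).symm.mul_pow] at h
  exact h.symm

/-- The commutators of the generators, extended additively to a map from tensors to the centre of
the Mekler group. -/
noncomputable def commutatorHom (p : ℕ) (Γ : SimpleGraph W) :
    (W × W →₀ ZMod p) →+ Additive (Subgroup.center (MeklerGroup p Γ)) :=
  zmodFinsuppLift (fun q => .ofMul ⟨⁅gen p Γ q.1, gen p Γ q.2⁆, commutator_gen_mem_center _ _⟩)
    fun _ => congrArg Additive.ofMul (Subtype.ext (commutator_gen_pow _ _))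

theorem coe_commutatorHom_single_one (q : W × W) :
    ((commutatorHom p Γ (.single q 1)).toMul : MeklerGroup p Γ) = ⁅gen p Γ q.1, gen p Γ q.2⁆ := by
  rw [commutatorHom, zmodFinsuppLift_single_one, toMul_ofMul]

theorem exists_commutatorHom_eq_of_mem_commutator {g : MeklerGroup p Γ}
    (hg : g ∈ commutator (MeklerGroup p Γ)) : ∃ z, (commutatorHom p Γ z).toMul = g := by
  let N := (AddMonoidHom.toMultiplicativeLeft (commutatorHom p Γ)).range.map
    (Subgroup.center (MeklerGroup p Γ)).subtype
  have : N.Normal := by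
    refine ⟨fun n hn g => ?_⟩
    rwa [Subgroup.mem_center_iff.1 (Subgroup.map_subtype_le _ hn) g, mul_inv_cancel_right]
  have hN : commutator (MeklerGroup p Γ) ≤ N := by
    refine commutator_le_of_closure_eq_top (PresentedGroup.closure_range_of _) N ?_
    rintro _ ⟨x, rfl⟩ _ ⟨y, rfl⟩
    exact ⟨_, ⟨.ofAdd (.single (x, y) 1), rfl⟩, coe_commutatorHom_single_one (x, y)⟩
  obtain ⟨_, ⟨z, rfl⟩, hz⟩ := hN hg
  exact ⟨z.toAdd, hz⟩

theorem commutatorHom_single_swap [NeZero p] (q : W × W) (a : ZMod p) :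
    commutatorHom p Γ (.single q.swap a) = -commutatorHom p Γ (.single q a) := by
  have h : commutatorHom p Γ (.single q.swap 1) = -commutatorHom p Γ (.single q 1) := by
    refine Additive.toMul.injective (Subtype.ext ?_)
    rw [toMul_neg, InvMemClass.coe_inv, coe_commutatorHom_single_one, coe_commutatorHom_single_one,
      commutatorElement_inv]
    rfl
  obtain ⟨m, rfl⟩ := ZMod.natCast_zmod_surjective a
  rw [← nsmul_one, ← Finsupp.smul_single, ← Finsupp.smul_single, map_nsmul, map_nsmul, h, smul_neg]

variable [Fact p.Prime] [NeZero (2 : ZMod p)]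

theorem commutatorHom_eq_zero_of_mem {z : W × W →₀ ZMod p}
    (hz : z ∈ symmetricOffEdges (ZMod p) Γ) : commutatorHom p Γ z = 0 := by
  refine eq_zero_of_mem_symmetricOffEdges _ commutatorHom_single_swap (fun q a hq => ?_) hz
  obtain ⟨m, rfl⟩ := ZMod.natCast_zmod_surjective a
  rw [← nsmul_one, ← Finsupp.smul_single, map_nsmul]
  convert nsmul_zero m
  exact Subtype.ext ((coe_commutatorHom_single_one q).trans (commutator_gen_of_adj hq))

theorem commutatorElement_bilinExt (a b : BilinExt (meklerCocycle (ZMod p) Γ)) :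
    ⁅a, b⁆ = ⟨0, (symmetricOffEdges (ZMod p) Γ).mkQ (outerProduct (ZMod p) W a.fst b.fst)⟩ := by
  rw [BilinExt.commutatorElement_eq, meklerCocycle_sub_flip]

/-- The homomorphism from the Mekler group to the central extension. -/
noncomputable def toBilinExt (p : ℕ) [Fact p.Prime] [NeZero (2 : ZMod p)] (Γ : SimpleGraph W) :
    MeklerGroup p Γ →* BilinExt (meklerCocycle (ZMod p) Γ) :=
  PresentedGroup.toGroup (f := fun x => ⟨.single x 1, 0⟩) <| by
    rintro r ((⟨x, rfl⟩ | ⟨x, y, z, rfl⟩) | ⟨x, y, hxy, rfl⟩)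
    · rw [map_pow, FreeGroup.lift_apply_of, BilinExt.pow_eq (meklerCocycle_isAlt Γ)]
      ext <;> simp
    · simp only [map_commutatorElement, FreeGroup.lift_apply_of, commutatorElement_bilinExt]
      ext <;> simp
    · simp only [map_commutatorElement, FreeGroup.lift_apply_of, commutatorElement_bilinExt]
      have h := outerProduct_single_single_mem_symmetricOffEdges hxy (1 : ZMod p) 1
      ext
      · rfl
      · exact (Submodule.Quotient.mk_eq_zero _).2 h

theorem toBilinExt_gen (x : W) : toBilinExt p Γ (gen p Γ x) = ⟨.single x 1, 0⟩ :=
  PresentedGroup.toGroup.of _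

theorem toBilinExt_commutatorHom (z : W × W →₀ ZMod p) :
    toBilinExt p Γ (commutatorHom p Γ z).toMul = ⟨0, (symmetricOffEdges (ZMod p) Γ).mkQ z⟩ := by
  induction z using zmodFinsupp_induction with
  | zero => rw [map_zero, toMul_zero, Subgroup.coe_one, map_one, map_zero]; rfl
  | add y z hy hz =>
    rw [map_add, toMul_add, Subgroup.coe_mul, map_mul, hy, hz]
    ext <;> simp
  | single q =>
    rw [coe_commutatorHom_single_one, map_commutatorElement, toBilinExt_gen, toBilinExt_gen,
      commutatorElement_bilinExt, outerProduct_single_single, one_mul]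

theorem mem_commutator_of_fst_eq_zero {g : MeklerGroup p Γ} (hg : (toBilinExt p Γ g).fst = 0) :
    g ∈ commutator (MeklerGroup p Γ) := by
  let f : (W →₀ ZMod p) →+ Additive (Abelianization (MeklerGroup p Γ)) :=
    zmodFinsuppLift (fun x => .ofMul (Abelianization.of (gen p Γ x))) fun x => by
      rw [← ofMul_pow, ← map_pow, gen_pow, map_one, ofMul_one]
  have h : ((AddMonoidHom.toMultiplicativeLeft f).comp (BilinExt.fstHom _)).comp (toBilinExt p Γ) =
      Abelianization.of := by
    refine PresentedGroup.ext fun x => ?_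
    change (f (toBilinExt p Γ (gen p Γ x)).fst).toMul = _
    rw [toBilinExt_gen, zmodFinsuppLift_single_one]
    rfl
  rw [← Abelianization.ker_of, MonoidHom.mem_ker, ← h]
  change (f (toBilinExt p Γ g).fst).toMul = 1
  rw [hg, map_zero, toMul_zero]

theorem toBilinExt_injective : Function.Injective (toBilinExt p Γ) := by
  rw [injective_iff_map_eq_one]
  intro g hg
  obtain ⟨z, rfl⟩ := exists_commutatorHom_eq_of_mem_commutator <|
    mem_commutator_of_fst_eq_zero (congrArg BilinExt.fst hg)
  rw [toBilinExt_commutatorHom] at hg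
  have hz := (Submodule.Quotient.mk_eq_zero _).1 (congrArg BilinExt.snd hg)
  rw [commutatorHom_eq_zero_of_mem hz, toMul_zero, Subgroup.coe_one]

theorem exists_fst_toBilinExt_eq (u : W →₀ ZMod p) : ∃ g, (toBilinExt p Γ g).fst = u := by
  induction u using zmodFinsupp_induction with
  | zero => exact ⟨1, by rw [map_one, BilinExt.fst_one]⟩
  | single x => exact ⟨gen p Γ x, by rw [toBilinExt_gen]⟩
  | add u v hu hv =>
    obtain ⟨g, rfl⟩ := hu
    obtain ⟨h, rfl⟩ := hv
    exact ⟨g * h, by rw [map_mul, BilinExt.fst_mul]⟩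

theorem toBilinExt_surjective : Function.Surjective (toBilinExt p Γ) := by
  rintro ⟨u, c⟩
  obtain ⟨g, rfl⟩ := exists_fst_toBilinExt_eq (Γ := Γ) u
  obtain ⟨z, hz⟩ := Submodule.mkQ_surjective _ (c - (toBilinExt p Γ g).snd)
  refine ⟨g * (commutatorHom p Γ z).toMul, ?_⟩
  rw [map_mul, toBilinExt_commutatorHom, hz]
  ext <;> simp

/-- The Mekler group is the central extension by the cocycle of its graph. -/
noncomputable def equivBilinExt (p : ℕ) [Fact p.Prime] [NeZero (2 : ZMod p)] (Γ : SimpleGraph W) :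
    MeklerGroup p Γ ≃* BilinExt (meklerCocycle (ZMod p) Γ) :=
  MulEquiv.ofBijective (toBilinExt p Γ) ⟨toBilinExt_injective, toBilinExt_surjective⟩

end MeklerGroup

/-! ### Flips of CFI graphs -/

section Flips

variable {V : Type*} {Γ : SimpleGraph V} {T T' T'' : Set (Sym2 V)} {f g : Γ.Dart → ZMod 2}

theorem cfiLinkAdj_iff {o o' : Γ.Dart × ZMod 2} :
    CFILinkAdj Γ T o o' ↔
      o'.1 = o.1.symm ∧ o.2 + o'.2 = T.indicator (1 : Sym2 V → ZMod 2) o.1.edge := by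
  have h1 : ∀ a b : ZMod 2, ¬ a = b ↔ a + b = 1 := by decide
  by_cases h : o.1.edge ∈ T
  · simp [CFILinkAdj, h, h1]
  · simp [CFILinkAdj, h, CharTwo.add_eq_zero]

theorem cfiLinkAdj_right_unique {o r r' : Γ.Dart × ZMod 2}
    (h : CFILinkAdj Γ T o r) (h' : CFILinkAdj Γ T o r') : r = r' := by
  rw [cfiLinkAdj_iff] at h h'
  exact Prod.ext (h.1.trans h'.1.symm) (add_left_cancel (h.2.trans h'.2.symm))

/-- Exchange the external vertices `a` and `b` of the darts with `f d = 1`. -/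
def shiftBit (f : Γ.Dart → ZMod 2) (o : Γ.Dart × ZMod 2) : Γ.Dart × ZMod 2 := (o.1, o.2 + f o.1)

@[simp] theorem shiftBit_shiftBit (f : Γ.Dart → ZMod 2) (o : Γ.Dart × ZMod 2) :
    shiftBit f (shiftBit f o) = o := by
  simp [shiftBit, add_assoc, CharTwo.add_self_eq_zero]

/-- Exchanging `a` and `b` at both ends of an edge does not affect its twist. Hence `shiftBit f`
carries the links twisted at `T` to those twisted at `T'` when `f` has odd sum over the two darts
of exactly the edges in the symmetric difference of `T` and `T'`. -/
def MovesTwists (f : Γ.Dart → ZMod 2) (T T' : Set (Sym2 V)) : Prop :=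
  ∀ d, f d + f d.symm = T.indicator 1 d.edge + T'.indicator 1 d.edge

theorem MovesTwists.symm (hf : MovesTwists f T T') : MovesTwists f T' T := fun d =>
  (hf d).trans (add_comm _ _)

theorem MovesTwists.trans (hf : MovesTwists f T T') (hg : MovesTwists g T' T'') :
    MovesTwists (f + g) T T'' := fun d => by
  rw [Pi.add_apply, Pi.add_apply, add_add_add_comm, hf d, hg d, add_assoc,
    CharTwo.add_cancel_left]

theorem MovesTwists.cfiLinkAdj_shiftBit_iff (hf : MovesTwists f T T') (o o' : Γ.Dart × ZMod 2) :
    CFILinkAdj Γ T' (shiftBit f o) (shiftBit f o') ↔ CFILinkAdj Γ T o o' := by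
  rw [cfiLinkAdj_iff, cfiLinkAdj_iff]
  refine and_congr_right fun h : o'.1 = o.1.symm => ?_
  have key : ∀ a b s s' t t' : ZMod 2, s + s' = t + t' →
      (a + s + (b + s') = t' ↔ a + b = t) := by decide
  simpa only [shiftBit, h] using key o.2 o'.2 _ _ _ _ (hf o.1)

open scoped Classical in
/-- The indicator function of the dart from `v` to `w`. -/
noncomputable def dartIndicator (v w : V) (d : Γ.Dart) : ZMod 2 :=
  if d.toProd = (v, w) then 1 else 0

theorem movesTwists_dartIndicator {v w : V} (h : Γ.Adj v w) :
    MovesTwists (Γ := Γ) (dartIndicator v w) ∅ {s(v, w)} := by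
  classical
  rintro ⟨⟨x, y⟩, -⟩
  have hvw := h.ne
  simp only [dartIndicator, SimpleGraph.Dart.symm, Prod.swap_prod_mk, Prod.mk.injEq,
    Set.indicator_apply, Set.mem_empty_iff_false, Set.mem_singleton_iff, SimpleGraph.Dart.edge,
    Sym2.eq_iff, Pi.one_apply]
  grind

variable [Γ.LocallyFinite]

theorem sum_dartIndicator [DecidableEq V] {v w : V} (h : Γ.Adj v w) (x : V) :
    ∑ z : Γ.neighborSet x, dartIndicator v w (⟨(x, z), z.2⟩ : Γ.Dart) = if x = v then 1 else 0 := by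
  split_ifs with hx
  · subst hx
    rw [Finset.sum_eq_single_of_mem ⟨w, h⟩ (Finset.mem_univ _)]
    · exact if_pos rfl
    · exact fun z _ hz => if_neg fun h => hz (Subtype.ext (congrArg Prod.snd h))
  · exact Finset.sum_eq_zero fun z _ => if_neg fun h => hx (congrArg Prod.fst h)

/-- Shift the bits of pairs of external vertices, and fix all other pairs of vertices. Unlike a map
of vertices, this can change the number of twists by one. -/
def shiftPairs (f : Γ.Dart → ZMod 2) : CFIVertex Γ × CFIVertex Γ ≃ CFIVertex Γ × CFIVertex Γ :=
  Function.Involutive.toPerm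
    (fun
      | (Sum.inl o, Sum.inl o') => (Sum.inl (shiftBit f o), Sum.inl (shiftBit f o'))
      | (Sum.inl o, Sum.inr i) => (Sum.inl o, Sum.inr i)
      | (Sum.inr i, Sum.inl o) => (Sum.inr i, Sum.inl o)
      | (Sum.inr i, Sum.inr j) => (Sum.inr i, Sum.inr j)) <| by
    rintro ⟨o | i, o' | j⟩ <;> simp

/-- The isomorphism of centres induced by a change of twists. -/
noncomputable def MovesTwists.meklerCenterEquiv (F : Type*) [Field F] (hf : MovesTwists f T T') :
    MeklerCenter F (CFIGraphTwistedAt Γ T) ≃ₗ[F] MeklerCenter F (CFIGraphTwistedAt Γ T') :=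
  meklerCenterCongr F (shiftPairs f) (by rintro ⟨o | i, o' | j⟩ <;> rfl) <| by
    rintro ⟨o | i, o' | j⟩
    · exact hf.cfiLinkAdj_shiftBit_iff o o'
    all_goals exact Iff.rfl

variable (Γ) in
/-- The sets of darts containing an even number of darts from every vertex, as indicator
functions. -/
def evenFlips : AddSubgroup (Γ.Dart → ZMod 2) where
  carrier := {f | ∀ v, ∑ w : Γ.neighborSet v, f ⟨(v, w), w.2⟩ = 0}
  zero_mem' _ := Finset.sum_const_zero
  add_mem' hf hg v := by
    simp only [Pi.add_apply]
    rw [Finset.sum_add_distrib, hf v, hg v, add_zero]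
  neg_mem' hf v := by
    simp only [Pi.neg_apply]
    rw [Finset.sum_neg_distrib, hf v, neg_zero]

/-- The permutation of the vertices of CFI graphs that exchanges the external vertices `a` and `b`
of the darts with `f d = 1`. Evenness of `f` makes it possible to change the internal vertices
accordingly. -/
def cfiFlip (f : evenFlips Γ) : CFIVertex Γ ≃ CFIVertex Γ :=
  Function.Involutive.toPerm
    (Sum.map (shiftBit f) fun i => ⟨i.1, fun w => i.2.1 w + f.1 ⟨(i.1, w), w.2⟩, by
      rw [Finset.sum_add_distrib, i.2.2, f.2 i.1, add_zero]⟩) <| by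
    rintro (o | ⟨v, m, hm⟩)
    · simp
    · simp [add_assoc, CharTwo.add_self_eq_zero]

theorem cfiGadgetAdj_shiftBit_iff {o : Γ.Dart × ZMod 2} {v : V}
    {m m' : {m : Γ.neighborSet v → ZMod 2 // ∑ w, m w = 0}}
    (hm : ∀ w, m'.1 w = m.1 w + f ⟨(v, w), w.2⟩) :
    CFIGadgetAdj Γ (shiftBit f o) ⟨v, m'⟩ ↔ CFIGadgetAdj Γ o ⟨v, m⟩ := by
  refine exists_congr fun w => and_congr_right fun h => ?_
  have ho : o.1 = ⟨(v, w), w.2⟩ := SimpleGraph.Dart.ext _ _ h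
  rw [hm w, ← ho]
  exact add_left_inj _

/-- A flip is an isomorphism of the CFI graphs whose twists it interchanges. -/
def cfiFlipIso (f : evenFlips Γ) (hf : MovesTwists f.1 T T') :
    CFIGraphTwistedAt Γ T ≃g CFIGraphTwistedAt Γ T' where
  toEquiv := cfiFlip f
  map_rel_iff' {x y} := by
    rcases x with o | ⟨v, m⟩ <;> rcases y with o' | ⟨v', m'⟩
    · exact hf.cfiLinkAdj_shiftBit_iff o o'
    · exact cfiGadgetAdj_shiftBit_iff fun _ => rfl
    · exact cfiGadgetAdj_shiftBit_iff fun _ => rfl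
    · exact Iff.rfl

theorem exists_evenFlip_movesTwists_of_adj_of_adj {v w w' : V} (h : Γ.Adj v w) (h' : Γ.Adj v w') :
    ∃ f : evenFlips Γ, MovesTwists f.1 {s(v, w)} {s(v, w')} := by
  classical
  refine ⟨⟨dartIndicator v w + dartIndicator v w', fun x => ?_⟩,
    (movesTwists_dartIndicator h).symm.trans (movesTwists_dartIndicator h')⟩
  simp only [Pi.add_apply]
  rw [Finset.sum_add_distrib, sum_dartIndicator h, sum_dartIndicator h']
  exact CharTwo.add_self_eq_zero _

theorem exists_evenFlip_movesTwists_of_connected (hconn : Γ.Connected) {e e' : Sym2 V}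
    (he : e ∈ Γ.edgeSet) (he' : e' ∈ Γ.edgeSet) :
    ∃ f : evenFlips Γ, MovesTwists f.1 {e} {e'} := by
  induction e with | _ v w
  induction e' with | _ v' w'
  rw [SimpleGraph.mem_edgeSet] at he he'
  obtain ⟨q⟩ := hconn.preconnected v v'
  induction q generalizing w with
  | nil => exact exists_evenFlip_movesTwists_of_adj_of_adj he he'
  | cons hadj _ ih =>
    obtain ⟨f, hf⟩ := exists_evenFlip_movesTwists_of_adj_of_adj he hadj
    obtain ⟨g, hg⟩ := ih _ hadj.symm he'
    rw [Sym2.eq_swap] at hg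
    exact ⟨f + g, hf.trans hg⟩

end Flips

/-! ### Free edges -/

theorem exists_mem_apply_eq_row_sub_column {R W : Type*} [CommRing R] {U : Submodule R (W →₀ R)}
    {z : W × W →₀ R} (hz : z ∈ Submodule.map₂ (outerProduct R W) U U) (x : W) :
    ∃ u ∈ U, ∀ y, u y = z (x, y) - z (y, x) := by
  rw [Submodule.map₂_eq_span_image2] at hz
  induction hz using Submodule.span_induction with
  | mem _ h =>
    obtain ⟨u, hu, v, hv, rfl⟩ := h
    refine ⟨u x • v - v x • u, U.sub_mem (U.smul_mem _ hv) (U.smul_mem _ hu), fun y => ?_⟩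
    simp [mul_comm]
  | zero => exact ⟨0, U.zero_mem, fun y => by simp⟩
  | add z z' _ _ h h' =>
    obtain ⟨u, hu, hz⟩ := h
    obtain ⟨v, hv, hz'⟩ := h'
    refine ⟨u + v, U.add_mem hu hv, fun y => ?_⟩
    rw [Finsupp.add_apply, Finsupp.add_apply, Finsupp.add_apply, hz, hz', sub_add_sub_comm]
  | smul c z _ h =>
    obtain ⟨u, hu, hz⟩ := h
    refine ⟨c • u, U.smul_mem c hu, fun y => ?_⟩
    rw [Finsupp.smul_apply, Finsupp.smul_apply, Finsupp.smul_apply, hz, smul_sub]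

section FreeEdges

variable {V : Type*} {Γ : SimpleGraph V} [Γ.LocallyFinite] {F : Type*} [Field F]
  {U : Submodule F (CFIVertex Γ →₀ F)} {e : Sym2 V}

/-- `o` is the only external vertex in the support of `u`. -/
def Isolates (u : CFIVertex Γ →₀ F) (o : Γ.Dart × ZMod 2) : Prop :=
  u (Sum.inl o) ≠ 0 ∧ ∀ r, r ≠ o → u (Sum.inl r) = 0

variable (F) in
/-- The action of a flip on vectors. -/
noncomputable def cfiFlipVectors (f : evenFlips Γ) :
    (CFIVertex Γ →₀ F) ≃ₗ[F] (CFIVertex Γ →₀ F) :=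
  Finsupp.domLCongr (cfiFlip f)

theorem isolates_cfiFlipVectors_iff {f : evenFlips Γ} {u : CFIVertex Γ →₀ F}
    {o : Γ.Dart × ZMod 2} :
    Isolates (cfiFlipVectors F f u) o ↔ Isolates u (shiftBit f.1 o) := by
  have hf : Function.Involutive (shiftBit f.1) := shiftBit_shiftBit f.1
  refine and_congr_right fun _ => ?_
  rw [hf.surjective.forall]
  refine forall_congr' fun r => imp_congr hf.eq_iff.not ?_
  change u (Sum.inl (shiftBit f.1 (shiftBit f.1 r))) = 0 ↔ _
  rw [hf r]

/-- The edges of `Γ` none of whose external vertices is isolated by a vector in `U`. As the two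
ends of an edge are matched, twisting the edge changes the products of vectors in `U` only if it is
not free. -/
def freeEdges (U : Submodule F (CFIVertex Γ →₀ F)) : Set (Sym2 V) :=
  {e | e ∈ Γ.edgeSet ∧ ∀ u ∈ U, ∀ o, Isolates u o → o.1.edge ≠ e}

theorem freeEdges_map_cfiFlipVectors (f : evenFlips Γ) :
    freeEdges (U.map (cfiFlipVectors F f : (CFIVertex Γ →₀ F) →ₗ[F] (CFIVertex Γ →₀ F))) =
      freeEdges U := by
  have hf : Function.Involutive (shiftBit f.1) := shiftBit_shiftBit f.1
  ext e
  refine and_congr_right fun _ => ?_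
  simp only [Submodule.mem_map, forall_exists_index, and_imp, forall_apply_eq_imp_iff₂]
  refine forall₂_congr fun u _ => ?_
  rw [hf.surjective.forall]
  refine forall_congr' fun o => imp_congr_left ?_
  exact isolates_cfiFlipVectors_iff.trans (by rw [hf o])

theorem linearIndependent_of_isolates {ι : Type*} {u : ι → CFIVertex Γ →₀ F}
    {o : ι → Γ.Dart × ZMod 2} (ho : Function.Injective o) (h : ∀ i, Isolates (u i) (o i)) :
    LinearIndependent F u := by
  refine .of_pairwise_dual_eq_zero_one _
    (fun i => (u i (.inl (o i)))⁻¹ • Finsupp.lapply (.inl (o i))) (fun i j hij => ?_) fun i => ?_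
  · change (u i (.inl (o i)))⁻¹ • u j _ = 0
    rw [(h j).2 _ (ho.ne hij), smul_zero]
  · exact inv_mul_cancel₀ (h i).1

theorem freeEdges_nonempty [FiniteDimensional F U]
    (hU : (Module.finrank F U : ℕ∞) < Γ.edgeSet.encard) : (freeEdges U).Nonempty := by
  by_contra hempty
  have h (e : Γ.edgeSet) : ∃ u : U, ∃ o, Isolates u.1 o ∧ o.1.edge = e := by
    by_contra! hcon
    exact hempty ⟨e, e.2, fun u hu o ho => hcon ⟨u, hu⟩ o ho⟩
  choose u o ho hoe using h
  have hinj : Function.Injective o := fun e e' h => Subtype.ext (by rw [← hoe, ← hoe, h])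
  have hli : LinearIndependent F u := .of_comp U.subtype (linearIndependent_of_isolates hinj ho)
  exact hU.not_ge (Cardinal.toENat_le_natCast.2 hli.cardinalMk_le_finrank)

theorem mem_symmetricOffEdges_of_mem_freeEdges {T T' : Set (Sym2 V)}
    (hT : ∀ e', e' ≠ e → (e' ∈ T ↔ e' ∈ T')) (he : e ∈ freeEdges U)
    {z : CFIVertex Γ × CFIVertex Γ →₀ F}
    (hz : z ∈ Submodule.map₂ (outerProduct F (CFIVertex Γ)) U U)
    (h : z ∈ symmetricOffEdges F (CFIGraphTwistedAt Γ T)) :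
    z ∈ symmetricOffEdges F (CFIGraphTwistedAt Γ T') := by
  intro q hq'
  by_cases hq : (CFIGraphTwistedAt Γ T).Adj q.1 q.2
  swap
  · exact h q hq
  obtain ⟨o | i, o' | j⟩ := q
  · have hlink : CFILinkAdj Γ T o o' := hq
    have hoe : o.1.edge = e := by
      by_contra hne
      exact hq' ⟨hlink.1, by rw [← hT _ hne]; exact hlink.2⟩
    obtain ⟨u, hu, hrow⟩ := exists_mem_apply_eq_row_sub_column hz (Sum.inl o)
    by_contra hne
    have hiso : Isolates u o' := by
      refine ⟨fun h0 => hne ?_, fun r hr => ?_⟩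
      · rw [hrow] at h0
        exact (sub_eq_zero.1 h0).symm
      · rw [hrow, ← h (Sum.inl o, Sum.inl r) fun hadj => hr (cfiLinkAdj_right_unique hadj hlink)]
        exact sub_self _
    exact he.2 u hu o' hiso (by rw [hlink.1, SimpleGraph.Dart.edge_symm, hoe])
  · exact (hq' hq).elim
  · exact (hq' hq).elim
  · exact hq.elim

theorem exists_meklerCocycle_eq_of_mem_freeEdges [FiniteDimensional F U] (he : e ∈ freeEdges U) :
    ∃ γ : MeklerCenter F (CFIGraph Γ) ≃ₗ[F] MeklerCenter F (twistedCFIGraph Γ e),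
      ∀ u ∈ U, ∀ v ∈ U, γ (meklerCocycle F (CFIGraph Γ) u v) =
        meklerCocycle F (twistedCFIGraph Γ e) u v := by
  obtain ⟨f, hf⟩ : ∃ f : Γ.Dart → ZMod 2, MovesTwists f ∅ {e} := by
    induction e with | _ v w
    exact ⟨_, movesTwists_dartIndicator he.1⟩
  have hT : ∀ e', e' ≠ e → (e' ∈ (∅ : Set (Sym2 V)) ↔ e' ∈ ({e} : Set (Sym2 V))) :=
    fun e' h => iff_of_false (Set.notMem_empty e') h
  let L := Submodule.map₂ (outerProduct F (CFIVertex Γ)) U U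
  have hU : U.FG := Module.Finite.iff_fg.1 inferInstance
  have : FiniteDimensional F L := Module.Finite.iff_fg.2 (hU.map₂ _ hU)
  let f₁ : L →ₗ[F] MeklerCenter F (CFIGraph Γ) := (Submodule.mkQ _).domRestrict L
  let f₂ : L →ₗ[F] MeklerCenter F (twistedCFIGraph Γ e) := (Submodule.mkQ _).domRestrict L
  have hker : LinearMap.ker f₁ = LinearMap.ker f₂ := by
    ext z
    simp only [f₁, f₂, LinearMap.mem_ker, LinearMap.domRestrict_apply, Submodule.mkQ_apply,
      Submodule.Quotient.mk_eq_zero]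
    exact ⟨mem_symmetricOffEdges_of_mem_freeEdges hT he z.2,
      mem_symmetricOffEdges_of_mem_freeEdges (fun e' h => (hT e' h).symm) he z.2⟩
  let ε : MeklerCenter F (CFIGraph Γ) ≃ₗ[F] MeklerCenter F (twistedCFIGraph Γ e) :=
    hf.meklerCenterEquiv F
  obtain ⟨γ, hγ⟩ := exists_linearEquiv_comp_eq (L := L) ε hker
  refine ⟨γ, fun u hu v hv => ?_⟩
  rw [meklerCocycle_apply, meklerCocycle_apply, map_smul]
  exact congrArg _ (hγ ⟨outerProduct F _ u v, Submodule.apply_mem_map₂ _ hu hv⟩)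

end FreeEdges

/-! ### Subgroup profiles -/

theorem exists_evenFlip_movesTwists_of_subset {V : Type*} {Γ : SimpleGraph V} [Γ.LocallyFinite]
    (hconn : Γ.Connected) {e : Sym2 V} (he : e ∈ Γ.edgeSet) (s : Set (Sym2 V)) :
    ∃ f : evenFlips Γ, s ⊆ Γ.edgeSet → s.Nonempty → ∃ e' ∈ s, MovesTwists f.1 {e'} {e} := by
  by_cases hs : s ⊆ Γ.edgeSet ∧ s.Nonempty
  · obtain ⟨hs, e', he'⟩ := hs
    obtain ⟨f, hf⟩ := exists_evenFlip_movesTwists_of_connected hconn (hs he') he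
    exact ⟨f, fun _ _ => ⟨e', he', hf⟩⟩
  · exact ⟨0, fun h h' => (hs ⟨h, h'⟩).elim⟩

theorem haveEqualSubgroupProfiles_bilinExt_cfiGraph {V : Type*} {Γ : SimpleGraph V}
    [Γ.LocallyFinite] (hconn : Γ.Connected) {e : Sym2 V} (he : e ∈ Γ.edgeSet) (F : Type*) [Field F]
    {k : ℕ} (hk : (k : ℕ∞) < Γ.edgeSet.encard) :
    HaveEqualSubgroupProfiles k (BilinExt (meklerCocycle F (CFIGraph Γ)))
      (BilinExt (meklerCocycle F (twistedCFIGraph Γ e))) := by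
  choose f hf using exists_evenFlip_movesTwists_of_subset hconn he
  refine BilinExt.haveEqualSubgroupProfiles (fun U => cfiFlipVectors F (f (freeEdges U))) ?_ ?_
  · exact bijective_choice_of_invariant (ρ := freeEdges) (ρ' := freeEdges) (h := fun _ s => s)
      (fun s => (Submodule.orderIsoMapComap (cfiFlipVectors F (f s))).bijective)
      (fun _ _ => freeEdges_map_cfiFlipVectors _) (fun _ => Function.injective_id)
      Function.bijective_id
  · rintro _ ⟨g, rfl⟩
    set U := Submodule.span F (Set.range g)
    have hdim : Module.finrank F U ≤ k := (finrank_range_le_card g).trans_eq (Fintype.card_fin k)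
    have : FiniteDimensional F U := .span_of_finite F (Set.finite_range g)
    have hfree : (freeEdges U).Nonempty :=
      freeEdges_nonempty (hk.trans_le' (Nat.cast_le.2 hdim))
    obtain ⟨e', he', hmoves⟩ := hf _ (fun _ h => h.1) hfree
    obtain ⟨γ, hγ⟩ := exists_meklerCocycle_eq_of_mem_freeEdges he'
    obtain ⟨δ, hδ⟩ := exists_meklerCocycle_congr (F := F) (cfiFlipIso _ hmoves)
    exact ⟨γ.trans δ, fun u hu v hv => (congrArg δ (hγ u hu v hv)).trans (hδ u v)⟩

theorem mainTheorem7_general {V : Type*} (Γ₀ : SimpleGraph V) [Γ₀.LocallyFinite]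
    (hconn : Γ₀.Connected) (e : Sym2 V) (he : e ∈ Γ₀.edgeSet)
    (p : ℕ) (hp : p.Prime) (hodd : p ≠ 2) (k : ℕ) (hk : (k : ℕ∞) < Γ₀.edgeSet.encard) :
    HaveEqualSubgroupProfiles k
      (MeklerGroup p (CFIGraph Γ₀)) (MeklerGroup p (twistedCFIGraph Γ₀ e)) := by
  have : Fact p.Prime := ⟨hp⟩
  have : NeZero (2 : ZMod p) := ⟨Ring.two_ne_zero (by rwa [ringChar.eq (ZMod p) p])⟩
  exact ((HaveEqualSubgroupProfiles.of_mulEquiv (MeklerGroup.equivBilinExt p _)).trans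
    (haveEqualSubgroupProfiles_bilinExt_cfiGraph hconn he (ZMod p) hk)).trans
    (.of_mulEquiv (MeklerGroup.equivBilinExt p _).symm)

theorem mainTheorem7 {V : Type*} [Fintype V] [DecidableEq V]
    (Γ₀ : SimpleGraph V) [DecidableRel Γ₀.Adj]
    (hreg : Γ₀.IsRegularOfDegree 3) (hconn : Γ₀.Connected)
    (e : Sym2 V) (he : e ∈ Γ₀.edgeSet)
    (p : ℕ) (hp : p.Prime) (hodd : p ≠ 2)
    (k : ℕ) (hk : (k : ℚ) < (Γ₀.edgeFinset.card : ℚ) / 10) :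
    HaveEqualSubgroupProfiles k
      (MeklerGroup p (CFIGraph Γ₀)) (MeklerGroup p (twistedCFIGraph Γ₀ e)) := by
  refine mainTheorem7_general Γ₀ hconn e he p hp hodd k ?_
  rw [← SimpleGraph.coe_edgeFinset, Set.encard_coe_eq_coe_finsetCard, Nat.cast_lt]
  exact_mod_cast hk.trans_le (div_le_self (Nat.cast_nonneg _) (by norm_num))
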